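/- Let $(K,v)$ be a valued field (written additively) with value group $\Gamma_v=v(K^\times)$, and let $\Gamma_{\mathbb Q}$ be the divisible hull of $\Gamma_v$. For $a\in K$ and $\gamma\in\Gamma_v$ let $B(a,\gamma)=\{b\in K\mid v(b-a)\ge\gamma\}$, and let $v_{a,\gamma}$ be the valuation on $K[x]$ with $v_{a,\gamma}\big(\sum_i a_i(x-a)^i\big)=\min_i\{v(a_i)+i\gamma\}$. An *approximation type* over $(K,v)$ is a set $\mathbf A$ of closed balls $B(a,\gamma)$ that is totally ordered by inclusion and contains every closed ball which contains a member of $\mathbf A$. Let $\mathbb A$ be the set of approximation types, and let $\mathrm{supp}(\mathbf A)\subseteq\Gamma_v$ be the set of radii of the balls in $\mathbf A$. A *pseudo-Cauchy sequence* is a family $\underline a=\{a_i\}_{i\in I}$ of pairwise distinct elements of $K$, indexed by a well-ordered set $I$ with at least two elements, such that $v(a_i-a_j)<v(a_j-a_k)$ for all $i<j<k$ in $I$. Let $\mathbb S$ be the set of pseudo-Cauchy sequences. Let $I^*$ be $I$ without its last element, if there is one, and $I^*=I$ otherwise; for $i\in I^*$ put $\gamma_i=v(a_{i+1}-a_i)$.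 Let $\iota(\underline a)\in\mathbb A$ be the set of all closed balls containing $B(a_i,\gamma_i)$ for some $i\in I^*$. Let $\mathbb V$ be the set of equivalence classes of valuations on $K[x]$ (possibly with nontrivial support) whose restriction to $K$ is equivalent to $v$. A quasi-cut of $\Gamma_{\mathbb Q}$ is a pair $(L,R)$ of subsets with $L\le R$ and $L\cup R=\Gamma_{\mathbb Q}$; put $(L,R)\le(L',R')$ if $L\subseteq L'$ and $R\supseteq R'$. For a valuation $\mu$ in a class in $\mathbb V$ and $f\in K[x]$ let $\delta_\mu(f)=\infty$ if $\mu(f)=\infty$, and otherwise let $\delta_\mu(f)$ be the quasi-cut $\big(\{q\in\Gamma_{\mathbb Q}\mid q\le\mu(f)\},\{q\in\Gamma_{\mathbb Q}\mid q\ge\mu(f)\}\big)$, where $q=v(c)/n$ (with $c\in K^\times$, $n\ge 1$) is compared with $\mu(f)$ by comparing $\mu(c)$ with $n\mu(f)$. This depends only on the class $[\mu]$ and $f$. Put $[\mu]\le[\nu]$ if $\delta_\mu(f)\le\delta_\nu(f)$ for all $f\in K[x]$, where $\infty$ is larger than every quasi-cut. Suprema in $\mathbb V$ are taken with respect to this relation.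 **Theorem.** (i) For every $\mathbf A\in\mathbb A$ and every choice of centres $a_\gamma\in K$ with $B(a_\gamma,\gamma)\in\mathbf A$ for $\gamma\in\mathrm{supp}(\mathbf A)$, the family $\{[v_{a_\gamma,\gamma}]\mid\gamma\in\mathrm{supp}(\mathbf A)\}$ has a unique supremum $\Phi(\mathbf A)$ in $\mathbb V$, and $\Phi(\mathbf A)$ does not depend on the choice of centres; so $\Phi:\mathbb A\to\mathbb V$ is well defined. Likewise, for every $\underline a\in\mathbb S$, the family $\{[v_{a_i,\gamma_i}]\mid i\in I^*\}$ has a unique supremum $\Psi(\underline a)$ in $\mathbb V$. (ii) $\Phi$ is injective. (iii) $\Psi=\Phi\circ\iota$. -/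

import Mathlib

open Polynomial

universe u w s

namespace ValApprox

noncomputable section

variable {K : Type u} [Field K] {Γ : Type w} [AddCommGroup Γ] [LinearOrder Γ]
  [IsOrderedAddMonoid Γ]

/-! ### The value group, closed balls, approximation types -/

/-- The value group `Γ_v` of a (Krull) valuation `v` on a field. -/
def valueGroup (v : AddValuation K (WithTop Γ)) : AddSubgroup Γ where
  carrier := {γ | ∃ c : K, v c = (γ : WithTop Γ)}
  zero_mem' := ⟨1, by simp⟩
  add_mem' := by
    rintro γ δ ⟨c, hc⟩ ⟨d, hd⟩
    exact ⟨c * d, by simp [hc, hd]⟩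
  neg_mem' := by
    rintro γ ⟨c, hc⟩
    refine ⟨c⁻¹, ?_⟩
    rw [AddValuation.map_inv, hc]
    rfl

/-- The closed ball `B(a, γ) = {b | v (b - a) ≥ γ}`, with radius `γ` in the value group. -/
def closedBall (v : AddValuation K (WithTop Γ)) (a : K) (γ : valueGroup v) : Set K :=
  {b | ((γ : Γ) : WithTop Γ) ≤ v (b - a)}

/-- The sets which are closed balls with radius in the value group. -/
def IsBall (v : AddValuation K (WithTop Γ)) (B : Set K) : Prop :=
  ∃ (a : K) (γ : valueGroup v), B = closedBall v a γ

/-- The closure of a family of balls under enlargement: all closed balls that contain a member. -/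
def enlarge (v : AddValuation K (WithTop Γ)) (𝓑 : Set (Set K)) : Set (Set K) :=
  {B | IsBall v B ∧ ∃ B' ∈ 𝓑, B' ⊆ B}

/-- An approximation type over `(K, v)`: a nest of closed balls, that is, a set of closed balls
totally ordered by inclusion, which is closed under enlargement. -/
structure ApproxType (v : AddValuation K (WithTop Γ)) where
  carrier : Set (Set K)
  isBall : ∀ B ∈ carrier, IsBall v B
  chain : IsChain (· ⊆ ·) carrier
  enlarge_eq : enlarge v carrier = carrier

/-- The support of an approximation type: the radii of the balls in it. -/
def ApproxType.supp {v : AddValuation K (WithTop Γ)} (A : ApproxType v) : Set (valueGroup v) :=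
  {γ | ∃ a : K, closedBall v a γ ∈ A.carrier}

theorem closedBall_subset {v : AddValuation K (WithTop Γ)} {a b : K} {γ δ : valueGroup v}
    (h : γ ≤ δ) (hab : ((γ : Γ) : WithTop Γ) ≤ v (b - a)) :
    closedBall v b δ ⊆ closedBall v a γ := by
  intro c hc
  have h1 : ((γ : Γ) : WithTop Γ) ≤ v (c - b) :=
    le_trans (WithTop.coe_le_coe.2 h) hc
  have h2 := v.map_le_add h1 hab
  simpa [closedBall] using h2

theorem mem_closedBall_self (v : AddValuation K (WithTop Γ)) (a : K) (γ : valueGroup v) :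
    a ∈ closedBall v a γ := by
  simp [closedBall]

theorem IsBall.comparable {v : AddValuation K (WithTop Γ)} {B B' : Set K} (hB : IsBall v B)
    (hB' : IsBall v B') {c : K} (hc : c ∈ B) (hc' : c ∈ B') : B ⊆ B' ∨ B' ⊆ B := by
  obtain ⟨a, γ, rfl⟩ := hB
  obtain ⟨b, δ, rfl⟩ := hB'
  have key : ∀ {a b : K} {γ δ : valueGroup v}, c ∈ closedBall v a γ → c ∈ closedBall v b δ →
      γ ≤ δ → closedBall v b δ ⊆ closedBall v a γ := by
    intro a b γ δ hc hc' h
    refine closedBall_subset h ?_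
    have h1 : ((γ : Γ) : WithTop Γ) ≤ v (c - b) := le_trans (WithTop.coe_le_coe.2 h) hc'
    have h2 := v.map_le_sub (show ((γ : Γ) : WithTop Γ) ≤ v (c - a) from hc) h1
    simpa using h2
  rcases le_total γ δ with h | h
  · exact Or.inr (key hc hc' h)
  · exact Or.inl (key hc' hc h)

/-- The approximation type generated by a nest of balls. -/
def ApproxType.ofNest (v : AddValuation K (WithTop Γ)) (𝓑 : Set (Set K))
    (hB : ∀ B ∈ 𝓑, IsBall v B) (hc : IsChain (· ⊆ ·) 𝓑) : ApproxType v where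
  carrier := enlarge v 𝓑
  isBall := fun _ h => h.1
  chain := by
    rintro B ⟨hb, C, hC, hCB⟩ B' ⟨hb', C', hC', hCB'⟩ -
    rcases hc.total hC hC' with h | h
    · obtain ⟨a, γ, rfl⟩ := hB C hC
      exact hb.comparable hb' (hCB (mem_closedBall_self v a γ))
        (hCB' (h (mem_closedBall_self v a γ)))
    · obtain ⟨a, γ, rfl⟩ := hB C' hC'
      exact hb.comparable hb' (hCB (h (mem_closedBall_self v a γ)))
        (hCB' (mem_closedBall_self v a γ))
  enlarge_eq := by
    ext B
    constructor
    · rintro ⟨hb, C, ⟨-, D, hD, hDC⟩, hCB⟩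
      exact ⟨hb, D, hD, hDC.trans hCB⟩
    · intro h
      exact ⟨h.1, B, h, subset_rfl⟩

/-! ### Pseudo-Cauchy sequences -/

/-- A pseudo-Cauchy sequence: a family of pairwise distinct elements of `K`, indexed by a
well-ordered set `I` with at least two elements (which may have a last element), with
`v (a i - a j) < v (a j - a k)` for `i < j < k`. -/
structure PseudoCauchySeq (v : AddValuation K (WithTop Γ)) where
  I : Type s
  [linearOrder : LinearOrder I]
  [wellFoundedLT : WellFoundedLT I]
  [nontrivial : Nontrivial I]
  a : I → K
  injective : Function.Injective a
  pseudoCauchy : ∀ i j k : I, i < j → j < k → v (a i - a j) < v (a j - a k)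

namespace PseudoCauchySeq

attribute [instance] PseudoCauchySeq.linearOrder PseudoCauchySeq.wellFoundedLT
  PseudoCauchySeq.nontrivial

variable {v : AddValuation K (WithTop Γ)} (S : PseudoCauchySeq.{u, w, s} v)

/-- The set `I*`: all indices except the last one, if there is a last one. -/
def IStar : Type s := {i : S.I // ¬ IsMax i}

variable {S} in
theorem IStar.nonempty (i : S.IStar) : {j : S.I | i.1 < j}.Nonempty := by
  exact not_isMax_iff.1 i.2

/-- The successor `i + 1` of an index `i ∈ I*`. -/
def next (i : S.IStar) : S.I :=
  (wellFounded_lt (α := S.I)).min {j : S.I | i.1 < j} i.nonempty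

theorem lt_next (i : S.IStar) : i.1 < S.next i :=
  (wellFounded_lt (α := S.I)).min_mem {j : S.I | i.1 < j} i.nonempty

theorem next_le (i : S.IStar) {j : S.I} (h : i.1 < j) : S.next i ≤ j :=
  (wellFounded_lt (α := S.I)).min_le h

theorem val_ne_top (i : S.IStar) : v (S.a (S.next i) - S.a i.1) ≠ ⊤ := by
  rw [AddValuation.ne_top_iff, sub_ne_zero]
  exact fun h => (S.lt_next i).ne' (S.injective h)

/-- The radius `γ_i = v (a_{i+1} - a_i)`, for `i ∈ I*`. -/
def radius (i : S.IStar) : valueGroup v :=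
  ⟨(v (S.a (S.next i) - S.a i.1)).untop (S.val_ne_top i),
    S.a (S.next i) - S.a i.1, (WithTop.coe_untop _ _).symm⟩

theorem coe_radius (i : S.IStar) :
    (((S.radius i : valueGroup v) : Γ) : WithTop Γ) = v (S.a (S.next i) - S.a i.1) :=
  WithTop.coe_untop _ _

theorem radius_le (i : S.IStar) {j : S.I} (h : i.1 < j) :
    ((S.radius i : Γ) : WithTop Γ) ≤ v (S.a j - S.a i.1) := by
  rw [coe_radius]
  rcases (S.next_le i h).eq_or_lt with e | hlt
  · rw [e]
  · have h1 := S.pseudoCauchy _ _ _ (S.lt_next i) hlt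
    rw [v.map_sub_swap (S.a i.1), v.map_sub_swap (S.a (S.next i))] at h1
    have h2 := v.map_le_add le_rfl h1.le
    rwa [sub_add_sub_cancel, v.map_sub_swap, v.map_sub_swap (S.a i.1)] at h2

theorem radius_mono {i j : S.IStar} (h : i.1 < j.1) : S.radius i ≤ S.radius j := by
  have h1 : ((S.radius i : Γ) : WithTop Γ) ≤ ((S.radius j : Γ) : WithTop Γ) := by
    refine (S.radius_le i h).trans ?_
    rw [coe_radius, v.map_sub_swap, v.map_sub_swap (S.a (S.next j))]
    exact (S.pseudoCauchy _ _ _ h (S.lt_next j)).le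
  exact_mod_cast h1

/-- The nest of balls `{B(a_i, γ_i)}`, `i ∈ I*`, of a pseudo-Cauchy sequence. -/
def nest : Set (Set K) := Set.range fun i : S.IStar => closedBall v (S.a i.1) (S.radius i)

theorem nest_isChain : IsChain (· ⊆ ·) S.nest := by
  rintro _ ⟨i, rfl⟩ _ ⟨j, rfl⟩ hne
  rcases lt_trichotomy i.1 j.1 with h | h | h
  · exact Or.inr (closedBall_subset (S.radius_mono h) (S.radius_le i h))
  · exact absurd (by rw [Subtype.ext h]) hne
  · exact Or.inl (closedBall_subset (S.radius_mono h) (S.radius_le j h))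

/-- The map `ι` from pseudo-Cauchy sequences to approximation types. -/
def iota (S : PseudoCauchySeq.{u, w, s} v) : ApproxType v :=
  ApproxType.ofNest v S.nest (by rintro _ ⟨i, rfl⟩; exact ⟨_, _, rfl⟩) S.nest_isChain

end PseudoCauchySeq

/-! ### Monomial valuations -/

/-- The value `min_i (v (g_i) + i γ)` of a polynomial `g = ∑ g_i X ^ i`. -/
def weight (v : AddValuation K (WithTop Γ)) (γ : Γ) (g : K[X]) : WithTop Γ :=
  g.support.inf fun i => v (g.coeff i) + i • (γ : WithTop Γ)

section weight

variable {v : AddValuation K (WithTop Γ)} {γ : Γ}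

theorem weight_le (g : K[X]) (i : ℕ) : weight v γ g ≤ v (g.coeff i) + i • (γ : WithTop Γ) := by
  by_cases h : i ∈ g.support
  · exact Finset.inf_le (f := fun i => v (g.coeff i) + i • (γ : WithTop Γ)) h
  · rw [Polynomial.notMem_support_iff.1 h, AddValuation.map_zero, top_add]
    exact le_top

theorem le_weight {g : K[X]} {m : WithTop Γ}
    (h : ∀ i, m ≤ v (g.coeff i) + i • (γ : WithTop Γ)) : m ≤ weight v γ g :=
  Finset.le_inf fun i _ => h i

theorem weight_add (g h : K[X]) : min (weight v γ g) (weight v γ h) ≤ weight v γ (g + h) := by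
  refine le_weight fun i => ?_
  rw [coeff_add]
  calc min (weight v γ g) (weight v γ h)
      ≤ min (v (g.coeff i) + i • (γ : WithTop Γ)) (v (h.coeff i) + i • (γ : WithTop Γ)) :=
        min_le_min (weight_le g i) (weight_le h i)
    _ = min (v (g.coeff i)) (v (h.coeff i)) + i • (γ : WithTop Γ) := min_add_add_right _ _ _
    _ ≤ _ := by gcongr; exact v.map_add _ _

theorem term_mul (g h : K[X]) (p : ℕ × ℕ) :
    v (g.coeff p.1 * h.coeff p.2) + (p.1 + p.2) • (γ : WithTop Γ) =
      (v (g.coeff p.1) + p.1 • (γ : WithTop Γ)) + (v (h.coeff p.2) + p.2 • (γ : WithTop Γ)) := by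
  rw [AddValuation.map_mul, add_nsmul, add_add_add_comm]

theorem exists_weight_eq {g : K[X]} (hg : g ≠ 0) :
    weight v γ g ≠ ⊤ ∧ ∃ m, v (g.coeff m) + m • (γ : WithTop Γ) = weight v γ g ∧
      ∀ i < m, weight v γ g < v (g.coeff i) + i • (γ : WithTop Γ) := by
  have hex : ∃ m, v (g.coeff m) + m • (γ : WithTop Γ) = weight v γ g := by
    obtain ⟨m, -, hm⟩ := Finset.exists_mem_eq_inf g.support (support_nonempty.2 hg)
      fun i => v (g.coeff i) + i • (γ : WithTop Γ)
    exact ⟨m, hm.symm⟩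
  constructor
  · intro htop
    have h1 := weight_le (v := v) (γ := γ) g g.natDegree
    rw [htop, top_le_iff, WithTop.add_eq_top] at h1
    rcases h1 with h1 | h1
    · exact (leadingCoeff_ne_zero.2 hg) ((AddValuation.top_iff v).1 h1)
    · rw [← WithTop.coe_nsmul] at h1
      exact WithTop.coe_ne_top h1
  · classical
    exact ⟨Nat.find hex, Nat.find_spec hex, fun i hi =>
      lt_of_le_of_ne (weight_le g i) fun e => Nat.find_min hex hi e.symm⟩

theorem weight_mul (g h : K[X]) : weight v γ (g * h) = weight v γ g + weight v γ h := by
  by_cases hg : g = 0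
  · simp [hg, weight]
  by_cases hh : h = 0
  · simp [hh, weight]
  apply le_antisymm
  · obtain ⟨hgt, m, hm, hm'⟩ := exists_weight_eq (v := v) (γ := γ) hg
    obtain ⟨hht, n, hn, hn'⟩ := exists_weight_eq (v := v) (γ := γ) hh
    have hsum : (g * h).coeff (m + n) = g.coeff m * h.coeff n +
        ∑ p ∈ (Finset.HasAntidiagonal.antidiagonal (m + n)).erase (m, n), g.coeff p.1 * h.coeff p.2 := by
      rw [coeff_mul]
      exact (Finset.add_sum_erase _ (fun p : ℕ × ℕ => g.coeff p.1 * h.coeff p.2)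
        (show (m, n) ∈ Finset.HasAntidiagonal.antidiagonal (m + n) from
          Finset.HasAntidiagonal.mem_antidiagonal.2 rfl)).symm
    have hB : weight v γ g + weight v γ h ≠ ⊤ := by
      rw [Ne, WithTop.add_eq_top]; tauto
    have hrest : weight v γ g + weight v γ h <
        v (∑ p ∈ (Finset.HasAntidiagonal.antidiagonal (m + n)).erase (m, n), g.coeff p.1 * h.coeff p.2) +
          (m + n) • (γ : WithTop Γ) := by
      refine Finset.sum_induction (fun p : ℕ × ℕ => g.coeff p.1 * h.coeff p.2)
        (fun x => weight v γ g + weight v γ h < v x + (m + n) • (γ : WithTop Γ)) ?_ ?_ ?_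
      · intro x y hx hy
        refine lt_of_lt_of_le (lt_min hx hy) ?_
        rw [min_add_add_right]
        gcongr
        exact v.map_add _ _
      · rw [AddValuation.map_zero, top_add]
        exact lt_top_iff_ne_top.2 hB
      · rintro ⟨i, j⟩ hp
        rw [Finset.mem_erase, Finset.HasAntidiagonal.mem_antidiagonal] at hp
        obtain ⟨hne, hij⟩ := hp
        simp only at hij
        rw [← hij, term_mul g h (i, j)]
        rcases lt_trichotomy i m with hi | hi | hi
        · exact WithTop.add_lt_add_of_lt_of_le hht (hm' i hi) (weight_le h j)
        · exact absurd (by rw [Prod.mk.injEq]; omega) hne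
        · exact WithTop.add_lt_add_of_le_of_lt hgt (weight_le g i) (hn' j (by omega))
    have hmain : v (g.coeff m * h.coeff n) + (m + n) • (γ : WithTop Γ) =
        weight v γ g + weight v γ h := by
      rw [term_mul g h (m, n), hm, hn]
    have hlt : v (g.coeff m * h.coeff n) <
        v (∑ p ∈ (Finset.HasAntidiagonal.antidiagonal (m + n)).erase (m, n), g.coeff p.1 * h.coeff p.2) := by
      rw [← hmain] at hrest
      exact lt_of_add_lt_add_right hrest
    calc weight v γ (g * h) ≤ v ((g * h).coeff (m + n)) + (m + n) • (γ : WithTop Γ) :=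
          weight_le _ _
      _ = weight v γ g + weight v γ h := by
          rw [hsum, AddValuation.map_add_eq_of_lt_left v hlt, hmain]
  · refine le_weight fun k => ?_
    rw [coeff_mul]
    refine Finset.sum_induction (fun p : ℕ × ℕ => g.coeff p.1 * h.coeff p.2)
      (fun x => weight v γ g + weight v γ h ≤ v x + k • (γ : WithTop Γ)) ?_ ?_ ?_
    · intro x y hx hy
      refine (le_min hx hy).trans ?_
      rw [min_add_add_right]
      gcongr
      exact v.map_add _ _
    · rw [AddValuation.map_zero, top_add]
      exact le_top
    · rintro p hp
      rw [← Finset.HasAntidiagonal.mem_antidiagonal.1 hp, term_mul]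
      exact add_le_add (weight_le _ _) (weight_le _ _)

theorem weight_C (c : K) : weight v γ (C c) = v c := by
  apply le_antisymm
  · simpa using weight_le (v := v) (γ := γ) (C c) 0
  · refine le_weight fun i => ?_
    rcases i with _ | i
    · simp
    · simp

end weight

/-- The monomial valuation `v_{a,γ}`: `v_{a,γ} (∑ a_i (x - a) ^ i) = min_i (v (a_i) + i γ)`.
The coefficients of the `(x - a)`-expansion of `f` are those of `taylor a f = f (x + a)`. -/
def monomialVal (v : AddValuation K (WithTop Γ)) (a : K) (γ : Γ) :
    AddValuation K[X] (WithTop Γ) :=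
  AddValuation.of (fun f => weight v γ (taylor a f))
    (by simp [weight])
    (by
      have h := weight_C (v := v) (γ := γ) 1
      simpa using h)
    (fun f g => by
      rw [map_add]
      exact weight_add _ _)
    (fun f g => by
      rw [taylor_mul]
      exact weight_mul _ _)

theorem monomialVal_C (v : AddValuation K (WithTop Γ)) (a : K) (γ : Γ) (c : K) :
    monomialVal v a γ (C c) = v c := by
  change weight v γ (taylor a (C c)) = v c
  rw [taylor_C, weight_C]

/-! ### Classes of extensions of `v` to `K[x]` -/

/-- A valuation on `K[x]`, with values in any ordered abelian group `G` (with `∞` adjoined) and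
possibly with nontrivial support, whose restriction to `K` is equivalent to `v`. The groups are
taken in the universe of `Γ`; this loses nothing, since the value group of such a valuation embeds
in `(Γ ⊗ ℚ) × ℚ` as an abelian group. -/
structure Extension (v : AddValuation K (WithTop Γ)) where
  G : Type w
  [addCommGroup : AddCommGroup G]
  [linearOrder : LinearOrder G]
  [isOrderedAddMonoid : IsOrderedAddMonoid G]
  val : AddValuation K[X] (WithTop G)
  restrict_isEquiv : (val.comap C).IsEquiv v

attribute [instance] Extension.addCommGroup Extension.linearOrder Extension.isOrderedAddMonoid

instance Extension.setoid (v : AddValuation K (WithTop Γ)) : Setoid (Extension v) where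
  r μ ν := μ.val.IsEquiv ν.val
  iseqv := ⟨fun _ => .refl, fun h => h.symm, fun h h' => h.trans h'⟩

/-- The set `𝕍` of equivalence classes of valuations on `K[x]` whose restriction to `K` is
equivalent to `v`. -/
def ExtClass (v : AddValuation K (WithTop Γ)) : Type (max u (w + 1)) :=
  Quotient (Extension.setoid v)

/-- The class `[v_{a,γ}]` of a monomial valuation. -/
def monomialClass (v : AddValuation K (WithTop Γ)) (a : K) (γ : valueGroup v) : ExtClass v :=
  Quotient.mk (Extension.setoid v)
    { G := Γ
      val := monomialVal v a γ
      restrict_isEquiv := AddValuation.IsEquiv.of_eq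
        (AddValuation.ext fun c => monomialVal_C v a γ c) }

/-! ### Quasi-cuts and the order on classes -/

/-- A quasi-cut in a totally ordered set `Q`: a pair of subsets `L ≤ R` which cover `Q`. -/
@[ext]
structure QuasiCut (Q : Type*) [LinearOrder Q] where
  L : Set Q
  R : Set Q
  le : ∀ p ∈ L, ∀ q ∈ R, p ≤ q
  cover : L ∪ R = Set.univ

instance (Q : Type*) [LinearOrder Q] : PartialOrder (QuasiCut Q) where
  le δ ε := δ.L ⊆ ε.L ∧ ε.R ⊆ δ.R
  le_refl _ := ⟨subset_rfl, subset_rfl⟩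
  le_trans _ _ _ h h' := ⟨h.1.trans h'.1, h'.2.trans h.2⟩
  le_antisymm _ _ h h' := QuasiCut.ext (h.1.antisymm h'.1) (h'.2.antisymm h.2)

namespace Extension

variable {v : AddValuation K (WithTop Γ)}

/-- The quasi-cut `({q | q ≤ μ f}, {q | q ≥ μ f})` of `Γ_ℚ`, the divisible hull of the value
group of `v`. An element `q` of `Γ_ℚ` is `v c / n` for some nonzero `c` in `K` and some `n > 0`,
and it is compared with `μ f` by comparing `μ c` with `n • μ f`. -/
def cut (μ : Extension v) (f : K[X]) : QuasiCut (DivisibleHull (valueGroup v)) where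
  L := {q | ∃ (γ : valueGroup v) (n : ℕ+) (c : K), q = DivisibleHull.mk γ n ∧
    v c = ((γ : Γ) : WithTop Γ) ∧ μ.val (C c) ≤ (n : ℕ) • μ.val f}
  R := {q | ∃ (γ : valueGroup v) (n : ℕ+) (c : K), q = DivisibleHull.mk γ n ∧
    v c = ((γ : Γ) : WithTop Γ) ∧ (n : ℕ) • μ.val f ≤ μ.val (C c)}
  le := by
    rintro _ ⟨γ, n, c, rfl, hc, h⟩ _ ⟨δ, m, d, rfl, hd, h'⟩
    rw [DivisibleHull.mk_le_mk]
    have h1 : μ.val (C (c ^ (m : ℕ))) ≤ μ.val (C (d ^ (n : ℕ))) := by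
      simp only [C_pow, AddValuation.map_pow]
      calc (m : ℕ) • μ.val (C c) ≤ (m : ℕ) • ((n : ℕ) • μ.val f) := nsmul_le_nsmul_right h _
        _ = (n : ℕ) • ((m : ℕ) • μ.val f) := smul_comm _ _ _
        _ ≤ (n : ℕ) • μ.val (C d) := nsmul_le_nsmul_right h' _
    have h2 : v (c ^ (m : ℕ)) ≤ v (d ^ (n : ℕ)) := (μ.restrict_isEquiv _ _).1 h1
    rw [AddValuation.map_pow, AddValuation.map_pow, hc, hd] at h2
    exact_mod_cast h2
  cover := by
    rw [Set.eq_univ_iff_forall]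
    intro q
    induction q with
    | mk γ n =>
      obtain ⟨c, hc⟩ := γ.2
      rcases le_total (μ.val (C c)) ((n : ℕ) • μ.val f) with h | h
      · exact Or.inl ⟨γ, n, c, rfl, hc, h⟩
      · exact Or.inr ⟨γ, n, c, rfl, hc, h⟩

open scoped Classical in
/-- The position of `μ f` relative to `Γ_ℚ`, as an element of `Qcuts(Γ_ℚ) ∪ {∞}`. -/
def pos (μ : Extension v) (f : K[X]) : WithTop (QuasiCut (DivisibleHull (valueGroup v))) :=
  if μ.val f = ⊤ then ⊤ else (μ.cut f : QuasiCut (DivisibleHull (valueGroup v)))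

theorem pos_eq_of_isEquiv {μ ν : Extension v} (h : μ.val.IsEquiv ν.val) : μ.pos = ν.pos := by
  funext f
  have h1 : μ.val f = ⊤ ↔ ν.val f = ⊤ := by
    simpa only [AddValuation.map_zero] using h.val_eq (r := f) (s := 0)
  have h2 : ∀ (n : ℕ) (g : K[X]), μ.val g ≤ n • μ.val f ↔ ν.val g ≤ n • ν.val f := by
    intro n g
    rw [← AddValuation.map_pow, ← AddValuation.map_pow]
    exact h _ _
  have h3 : ∀ (n : ℕ) (g : K[X]), n • μ.val f ≤ μ.val g ↔ n • ν.val f ≤ ν.val g := by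
    intro n g
    rw [← AddValuation.map_pow, ← AddValuation.map_pow]
    exact h _ _
  have h4 : μ.cut f = ν.cut f := by
    ext q <;> simp only [cut, h2, h3]
  simp only [pos, h1, h4]

end Extension

/-- The position of the value at `f` of any member of a class, in `Qcuts(Γ_ℚ) ∪ {∞}`. -/
def ExtClass.pos {v : AddValuation K (WithTop Γ)} (M : ExtClass v) :
    K[X] → WithTop (QuasiCut (DivisibleHull (valueGroup v))) :=
  Quotient.lift Extension.pos (fun _ _ h => Extension.pos_eq_of_isEquiv h) M

/-- The pointwise order on `𝕍`: `M ≤ N` if at every polynomial the value of `M` is at most the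
value of `N`, both taken in `Qcuts(Γ_ℚ) ∪ {∞}`. -/
instance (v : AddValuation K (WithTop Γ)) : Preorder (ExtClass v) :=
  Preorder.lift ExtClass.pos

end

end ValApprox

open ValApprox

/-! Everything rests on three facts. (1) The relation on `ExtClass v` is antisymmetric, so suprema
are unique. Inequalities between values in `Γ_ℚ` are read off the cuts; if a nonzero polynomial has
a value outside `Γ_ℚ`, take `Q` of least degree with this property. By `Q`-adic expansion every
nonzero value is that of some `a * Q ^ i` with the value of `a` in `Γ_ℚ`, and comparing two such
monomials reduces, after cancelling powers of `Q`, to a comparison with an element of `Γ_ℚ`. (2)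
Suprema exist. Along a nonempty nest the values `v_{a,γ}(f)` increase as the balls shrink, so an
ultraproduct along an ultrafilter finer than `atTop` has as lower cut set at `f` the union of the
lower sets and as upper cut set the intersection of the upper sets (`isLUB_ultraExt`). The empty
nest needs the least class, obtained by giving `x` a value below all of `Γ_ℚ` (`exists_nsmul_lt`).
(3) The nest is recovered from its supremum: since `v_{b,δ}(x - a) = min (v (b - a)) δ`, the value
of `x - a` reaches `γ` exactly when `B(a,γ)` contains a ball of the nest. This gives injectivity.
Part (iii) holds because the balls `B(a_i,γ_i)` are cofinal in the nest they generate. -/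

namespace ValApprox

/-! ### Multiples in an ordered group with infinity -/

section WithTop

variable {G : Type*} [AddCommGroup G] [LinearOrder G] [IsOrderedAddMonoid G]

theorem withTop_nsmul_top {n : ℕ} (hn : n ≠ 0) : n • (⊤ : WithTop G) = ⊤ := by
  obtain ⟨m, rfl⟩ := Nat.exists_eq_succ_of_ne_zero hn
  rw [succ_nsmul, add_top]

theorem withTop_nsmul_le_nsmul_iff {n : ℕ} (hn : n ≠ 0) {x y : WithTop G} :
    n • x ≤ n • y ↔ x ≤ y := by
  induction y with
  | top => simp [withTop_nsmul_top hn]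
  | coe y =>
    induction x with
    | top =>
      rw [withTop_nsmul_top hn, ← WithTop.coe_nsmul]
      simp only [top_le_iff, WithTop.coe_ne_top]
    | coe x =>
      rw [← WithTop.coe_nsmul, ← WithTop.coe_nsmul, WithTop.coe_le_coe, WithTop.coe_le_coe]
      exact nsmul_le_nsmul_iff_right hn

end WithTop

variable {K : Type u} [Field K] {Γ : Type w} [AddCommGroup Γ] [LinearOrder Γ]
  [IsOrderedAddMonoid Γ] {v : AddValuation K (WithTop Γ)}

theorem exists_coe_eq {c : K} (hc : c ≠ 0) :
    ∃ γ : valueGroup v, v c = ((γ : Γ) : WithTop Γ) := by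
  obtain ⟨γ, hγ⟩ := WithTop.ne_top_iff_exists.1 ((AddValuation.ne_top_iff v).2 hc)
  exact ⟨⟨γ, c, hγ.symm⟩, hγ.symm⟩

theorem ne_zero_of_eq_coe {c : K} {γ : Γ} (h : v c = (γ : WithTop Γ)) : c ≠ 0 := by
  rw [← AddValuation.ne_top_iff v, h]
  exact WithTop.coe_ne_top

/-! ### Comparing values with the divisible hull -/

namespace Extension

theorem val_C_le_val_C (μ : Extension v) {c d : K} : μ.val (C c) ≤ μ.val (C d) ↔ v c ≤ v d :=
  μ.restrict_isEquiv d c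

theorem val_C_ne_top (μ : Extension v) {c : K} (hc : c ≠ 0) : μ.val (C c) ≠ ⊤ := by
  intro h
  have h1 : μ.val (C (0 : K)) ≤ μ.val (C c) := by rw [h]; exact le_top
  rw [μ.val_C_le_val_C, AddValuation.map_zero, top_le_iff, AddValuation.top_iff] at h1
  exact hc h1

/-- This makes membership in a cut independent of the fraction chosen to represent a point of the
divisible hull. -/
theorem nsmul_val_C_eq (μ : Extension v) {γ δ : valueGroup v} {n m : ℕ+} {c d : K}
    (h : DivisibleHull.mk γ n = DivisibleHull.mk δ m) (hc : v c = ((γ : Γ) : WithTop Γ))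
    (hd : v d = ((δ : Γ) : WithTop Γ)) :
    (m : ℕ) • μ.val (C c) = (n : ℕ) • μ.val (C d) := by
  have h1 : ∀ {γ δ : valueGroup v} {n m : ℕ+} {c d : K},
      DivisibleHull.mk γ n ≤ DivisibleHull.mk δ m → v c = ((γ : Γ) : WithTop Γ) →
      v d = ((δ : Γ) : WithTop Γ) → (m : ℕ) • μ.val (C c) ≤ (n : ℕ) • μ.val (C d) := by
    intro γ δ n m c d h hc hd
    rw [DivisibleHull.mk_le_mk] at h
    rw [← AddValuation.map_pow, ← AddValuation.map_pow, ← C_pow, ← C_pow, val_C_le_val_C,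
      AddValuation.map_pow, AddValuation.map_pow, hc, hd]
    exact_mod_cast h
  exact le_antisymm (h1 h.le hc hd) (h1 h.ge hd hc)

theorem mk_mem_cut_L (μ : Extension v) {f : K[X]} {γ : valueGroup v} {n : ℕ+} {c : K}
    (hc : v c = ((γ : Γ) : WithTop Γ)) :
    DivisibleHull.mk γ n ∈ (μ.cut f).L ↔ μ.val (C c) ≤ (n : ℕ) • μ.val f := by
  constructor
  · rintro ⟨δ, m, d, e, hd, h⟩
    rw [← withTop_nsmul_le_nsmul_iff m.ne_zero, μ.nsmul_val_C_eq e hc hd, smul_comm]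
    exact nsmul_le_nsmul_right h _
  · exact fun h => ⟨γ, n, c, rfl, hc, h⟩

theorem mk_mem_cut_R (μ : Extension v) {f : K[X]} {γ : valueGroup v} {n : ℕ+} {c : K}
    (hc : v c = ((γ : Γ) : WithTop Γ)) :
    DivisibleHull.mk γ n ∈ (μ.cut f).R ↔ (n : ℕ) • μ.val f ≤ μ.val (C c) := by
  constructor
  · rintro ⟨δ, m, d, e, hd, h⟩
    rw [← withTop_nsmul_le_nsmul_iff m.ne_zero, μ.nsmul_val_C_eq e hc hd, smul_comm]
    exact nsmul_le_nsmul_right h _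
  · exact fun h => ⟨γ, n, c, rfl, hc, h⟩

/-- Elementary form of the comparison of the positions of `μ f` and `ν f`. -/
def LeAt (μ ν : Extension v) (f : K[X]) : Prop :=
  (∀ (n : ℕ) (c : K), n ≠ 0 → c ≠ 0 → μ.val (C c) ≤ n • μ.val f → ν.val (C c) ≤ n • ν.val f) ∧
  (∀ (n : ℕ) (c : K), n ≠ 0 → c ≠ 0 → n • ν.val f ≤ ν.val (C c) → n • μ.val f ≤ μ.val (C c)) ∧
  (μ.val f = ⊤ → ν.val f = ⊤)

/-- The third clause of `LeAt` is not implied by the cuts: an infinite value and a finite one above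
all of `Γ_ℚ` define the same cut. -/
theorem pos_le_pos_iff (μ ν : Extension v) (f : K[X]) : μ.pos f ≤ ν.pos f ↔ LeAt μ ν f := by
  by_cases hν : ν.val f = ⊤
  · simp only [pos, hν, if_true, le_top, true_iff]
    refine ⟨fun n c hn _ _ => ?_, fun n c hn hc h => ?_, fun _ => hν⟩
    · rw [hν, withTop_nsmul_top hn]; exact le_top
    · rw [hν, withTop_nsmul_top hn, top_le_iff] at h
      exact absurd h (ν.val_C_ne_top hc)
  by_cases hμ : μ.val f = ⊤
  · simp only [pos, hν, hμ, if_true, if_false, top_le_iff]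
    exact ⟨fun h => absurd h WithTop.coe_ne_top, fun h => absurd (h.2.2 hμ) hν⟩
  simp only [pos, hν, hμ, if_false, WithTop.coe_le_coe]
  constructor
  · rintro ⟨hL, hR⟩
    refine ⟨fun n c hn hc h => ?_, fun n c hn hc h => ?_, fun h => absurd h hμ⟩
    · obtain ⟨γ, hγ⟩ := exists_coe_eq (v := v) hc
      have := hL ((μ.mk_mem_cut_L (n := ⟨n, Nat.pos_of_ne_zero hn⟩) hγ).2 h)
      exact (ν.mk_mem_cut_L hγ).1 this
    · obtain ⟨γ, hγ⟩ := exists_coe_eq (v := v) hc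
      have := hR ((ν.mk_mem_cut_R (n := ⟨n, Nat.pos_of_ne_zero hn⟩) hγ).2 h)
      exact (μ.mk_mem_cut_R hγ).1 this
  · rintro ⟨hL, hR, -⟩
    constructor
    · rintro _ ⟨γ, n, c, rfl, hc, h⟩
      exact ⟨γ, n, c, rfl, hc, hL n c n.ne_zero (ne_zero_of_eq_coe hc) h⟩
    · rintro _ ⟨γ, n, c, rfl, hc, h⟩
      exact ⟨γ, n, c, rfl, hc, hR n c n.ne_zero (ne_zero_of_eq_coe hc) h⟩

/-- The class of an extension. -/
def toClass (μ : Extension v) : ExtClass v := Quotient.mk (Extension.setoid v) μ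

theorem toClass_le_toClass {μ ν : Extension v} :
    μ.toClass ≤ ν.toClass ↔ ∀ f, LeAt μ ν f :=
  forall_congr' fun f => pos_le_pos_iff μ ν f

/-! ### Classes are determined by their positions -/

/-- The value `μ f` is an element of the divisible hull of the value group of `v`. -/
def IsTorsion (μ : Extension v) (f : K[X]) : Prop :=
  ∃ (n : ℕ) (c : K), n ≠ 0 ∧ c ≠ 0 ∧ n • μ.val f = μ.val (C c)

section Torsion

variable {μ ν : Extension v} {f g : K[X]}

theorem IsTorsion.congr (h : μ.IsTorsion f) (e : μ.val g = μ.val f) : μ.IsTorsion g := by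
  unfold IsTorsion
  rwa [e]

/-- If `μ f` and `μ (f g ^ n)` are in the divisible hull, so is `μ g`. -/
theorem IsTorsion.of_mul_pow (hf : μ.IsTorsion f) {n : ℕ} (hn : n ≠ 0)
    (h : μ.IsTorsion (f * g ^ n)) : μ.IsTorsion g := by
  obtain ⟨m, c, hm, hc, e⟩ := hf
  obtain ⟨k, d, hk, hd, e'⟩ := h
  -- From `m μ(f) = μ(c)` and `k μ(f g ^ n) = μ(d)` one gets `m k n μ(g) = m μ(d) - k μ(c)`.
  refine ⟨m * k * n, d ^ m * (c ^ k)⁻¹, by positivity, by positivity, ?_⟩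
  have h1 : μ.val (C (d ^ m * (c ^ k)⁻¹)) + μ.val (C (c ^ k)) = μ.val (C (d ^ m)) := by
    rw [← AddValuation.map_mul, ← C_mul, inv_mul_cancel_right₀ (pow_ne_zero _ hc)]
  have h2 : (m * k * n) • μ.val g + μ.val (C (c ^ k)) = μ.val (C (d ^ m)) := by
    simp only [C_pow, AddValuation.map_pow, ← e, ← e', AddValuation.map_mul]
    module
  exact WithTop.add_right_cancel (μ.val_C_ne_top (pow_ne_zero _ hc)) (h2.trans h1.symm)

theorem IsTorsion.of_leAt (h₁ : LeAt μ ν f) (h₂ : LeAt ν μ f) (h : μ.IsTorsion f) :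
    ν.IsTorsion f := by
  obtain ⟨n, c, hn, hc, e⟩ := h
  exact ⟨n, c, hn, hc, le_antisymm (h₂.2.1 n c hn hc e.le) (h₁.1 n c hn hc e.ge)⟩

theorem IsTorsion.nsmul_val_eq_of_leAt (h₁ : LeAt μ ν f) (h₂ : LeAt ν μ f) {n : ℕ} {c : K}
    (hn : n ≠ 0) (hc : c ≠ 0) (e : n • μ.val f = μ.val (C c)) : n • ν.val f = ν.val (C c) :=
  le_antisymm (h₂.2.1 n c hn hc e.le) (h₁.1 n c hn hc e.ge)

/-- A torsion value is a point of `Γ_ℚ`, the same point for `μ` and `ν`; whether it lies below the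
value of `g` is decided by the cut of `g`. -/
theorem IsTorsion.val_le_of_leAt (hf : μ.IsTorsion f) (hf₁ : LeAt μ ν f) (hf₂ : LeAt ν μ f)
    (hg : LeAt μ ν g) (h : μ.val f ≤ μ.val g) : ν.val f ≤ ν.val g := by
  obtain ⟨n, c, hn, hc, e⟩ := hf
  have e' := IsTorsion.nsmul_val_eq_of_leAt hf₁ hf₂ hn hc e
  rw [← withTop_nsmul_le_nsmul_iff hn, e] at h
  rw [← withTop_nsmul_le_nsmul_iff hn, e']
  exact hg.1 n c hn hc h

theorem IsTorsion.le_val_of_leAt (hf : μ.IsTorsion f) (hf₁ : LeAt μ ν f) (hf₂ : LeAt ν μ f)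
    (hg : LeAt ν μ g) (h : μ.val g ≤ μ.val f) : ν.val g ≤ ν.val f := by
  obtain ⟨n, c, hn, hc, e⟩ := hf
  have e' := IsTorsion.nsmul_val_eq_of_leAt hf₁ hf₂ hn hc e
  rw [← withTop_nsmul_le_nsmul_iff hn, e] at h
  rw [← withTop_nsmul_le_nsmul_iff hn, e']
  exact hg.2.1 n c hn hc h

/-- If `Q` has minimal degree among the nonzero polynomials with value outside the divisible hull,
the values of every polynomial are those of a monomial in `Q`. -/
theorem exists_val_eq_mul_pow (h₁ : ∀ f, LeAt μ ν f) (h₂ : ∀ f, LeAt ν μ f) {Q : K[X]}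
    (hQ₀ : Q ≠ 0) (hQ : ¬ μ.IsTorsion Q)
    (hmin : ∀ f : K[X], f ≠ 0 → f.degree < Q.degree → μ.IsTorsion f) {f : K[X]} (hf : f ≠ 0) :
    ∃ (a : K[X]) (i : ℕ), μ.IsTorsion a ∧ μ.val f = μ.val (a * Q ^ i) ∧
      ν.val f = ν.val (a * Q ^ i) := by
  induction hd : f.natDegree using Nat.strong_induction_on generalizing f with
  | _ d ih =>
  by_cases hdeg : f.degree < Q.degree
  · exact ⟨f, 0, hmin f hf hdeg, by simp, by simp⟩
  rw [not_lt] at hdeg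
  -- Constants are torsion or zero, so `Q` is not constant and division by `Q` lowers the degree.
  have hQdeg : 0 < Q.degree := by
    by_contra hQd
    rw [eq_C_of_degree_le_zero (not_lt.1 hQd)] at hQ hQ₀
    exact hQ ⟨1, _, one_ne_zero, fun h => hQ₀ (by rw [h, C_0]), one_smul _ _⟩
  have hdiv : f / Q ≠ 0 := fun h => absurd ((Polynomial.div_eq_zero_iff hQ₀).1 h) hdeg.not_gt
  have hlt : (f / Q).natDegree < d := by
    rw [← hd]
    exact natDegree_lt_natDegree hdiv (degree_div_lt hf hQdeg)
  obtain ⟨a, i, ha, e, e'⟩ := ih _ hlt hdiv rfl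
  have hmul : μ.val (Q * (f / Q)) = μ.val (a * Q ^ (i + 1)) := by
    rw [AddValuation.map_mul, e, ← AddValuation.map_mul]; congr 1; ring
  have hmul' : ν.val (Q * (f / Q)) = ν.val (a * Q ^ (i + 1)) := by
    rw [AddValuation.map_mul, e', ← AddValuation.map_mul]; congr 1; ring
  have hsum : Q * (f / Q) + f % Q = f := EuclideanDomain.div_add_mod f Q
  by_cases hr : f % Q = 0
  · rw [hr, add_zero] at hsum
    rw [hsum] at hmul hmul'
    exact ⟨a, i + 1, ha, hmul, hmul'⟩
  have hrt : μ.IsTorsion (f % Q) := hmin _ hr (EuclideanDomain.mod_lt f hQ₀)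
  -- Equality would make `a * Q ^ (i + 1)` torsion, hence `Q` too. So the smaller of the two
  -- summands gives the value of `f`.
  have hne : μ.val (f % Q) ≠ μ.val (Q * (f / Q)) := fun h =>
    hQ (ha.of_mul_pow i.succ_ne_zero (hrt.congr (hmul.symm.trans h.symm)))
  -- The remainder is torsion, so the same summand is the smaller one for `ν`.
  rcases hne.lt_or_gt with h | h
  · have h' : ν.val (f % Q) < ν.val (Q * (f / Q)) := by
      by_contra hc
      exact h.not_ge ((hrt.of_leAt (h₁ _) (h₂ _)).le_val_of_leAt (h₂ _) (h₁ _) (h₁ _)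
        (not_lt.1 hc))
    refine ⟨f % Q, 0, hrt, ?_, ?_⟩
    · rw [pow_zero, mul_one, ← AddValuation.map_add_eq_of_lt_right _ h, hsum]
    · rw [pow_zero, mul_one, ← AddValuation.map_add_eq_of_lt_right _ h', hsum]
  · have h' : ν.val (Q * (f / Q)) < ν.val (f % Q) := by
      by_contra hc
      exact h.not_ge ((hrt.of_leAt (h₁ _) (h₂ _)).val_le_of_leAt (h₂ _) (h₁ _) (h₂ _)
        (not_lt.1 hc))
    refine ⟨a, i + 1, ha, ?_, ?_⟩
    · rw [← hmul, ← AddValuation.map_add_eq_of_lt_left _ h, hsum]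
    · rw [← hmul', ← AddValuation.map_add_eq_of_lt_left _ h', hsum]

/-- Cancelling the smaller power of `Q` leaves a bare `a` or `b`, which is torsion, on one side. -/
theorem val_mul_pow_le_of_leAt (h₁ : ∀ f, LeAt μ ν f) (h₂ : ∀ f, LeAt ν μ f) {Q a b : K[X]}
    (ha : μ.IsTorsion a) (hb : μ.IsTorsion b) {i j : ℕ}
    (h : μ.val (a * Q ^ i) ≤ μ.val (b * Q ^ j)) : ν.val (a * Q ^ i) ≤ ν.val (b * Q ^ j) := by
  rcases le_total i j with hij | hij
  · obtain ⟨k, rfl⟩ := Nat.exists_eq_add_of_le hij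
    rw [pow_add, mul_left_comm, mul_comm a, AddValuation.map_mul _ (Q ^ i),
      AddValuation.map_mul _ (Q ^ i)] at h ⊢
    -- An infinite factor cannot be cancelled, but it is then infinite for `ν` as well.
    by_cases ht : μ.val (Q ^ i) = ⊤
    · rw [(h₁ _).2.2 ht, top_add, top_add]
    · gcongr
      exact ha.val_le_of_leAt (h₁ _) (h₂ _) (h₁ _) ((WithTop.add_le_add_iff_left ht).1 h)
  · obtain ⟨k, rfl⟩ := Nat.exists_eq_add_of_le hij
    rw [pow_add, mul_left_comm, mul_comm b, AddValuation.map_mul _ (Q ^ j),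
      AddValuation.map_mul _ (Q ^ j)] at h ⊢
    by_cases ht : μ.val (Q ^ j) = ⊤
    · rw [(h₁ _).2.2 ht, top_add, top_add]
    · gcongr
      exact hb.le_val_of_leAt (h₁ _) (h₂ _) (h₂ _) ((WithTop.add_le_add_iff_left ht).1 h)

/-- Both values are replaced by those of monomials in a single `Q`, valid simultaneously for `μ` and
`ν`; if no `Q` is needed, `f` itself is torsion. -/
theorem val_le_of_leAt (h₁ : ∀ f, LeAt μ ν f) (h₂ : ∀ f, LeAt ν μ f)
    (h : μ.val f ≤ μ.val g) : ν.val f ≤ ν.val g := by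
  by_cases hg : g = 0
  · rw [hg, AddValuation.map_zero]; exact le_top
  by_cases hf : f = 0
  · rw [hf, AddValuation.map_zero, top_le_iff] at h
    rw [(h₁ g).2.2 h]; exact le_top
  by_cases hex : ∃ Q : K[X], Q ≠ 0 ∧ ¬ μ.IsTorsion Q
  · obtain ⟨Q, ⟨hQ₀, hQ⟩, hmin⟩ := (measure (natDegree (R := K))).wf.has_min
      {Q : K[X] | Q ≠ 0 ∧ ¬ μ.IsTorsion Q} hex
    have hmin' : ∀ f : K[X], f ≠ 0 → f.degree < Q.degree → μ.IsTorsion f := by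
      intro p hp hlt
      by_contra hpt
      exact hmin p ⟨hp, hpt⟩ (natDegree_lt_natDegree hp hlt)
    obtain ⟨a, i, ha, e, e'⟩ := exists_val_eq_mul_pow h₁ h₂ hQ₀ hQ hmin' hf
    obtain ⟨b, j, hb, k, k'⟩ := exists_val_eq_mul_pow h₁ h₂ hQ₀ hQ hmin' hg
    rw [e', k']
    rw [e, k] at h
    exact val_mul_pow_le_of_leAt h₁ h₂ ha hb h
  · push Not at hex
    exact (hex f hf).val_le_of_leAt (h₁ f) (h₂ f) (h₁ g) h

end Torsion

end Extension

/-- The pointwise preorder on classes of extensions is antisymmetric. -/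
theorem ExtClass.le_antisymm {M N : ExtClass v} (h : M ≤ N) (h' : N ≤ M) : M = N := by
  induction M using Quotient.inductionOn with | _ μ
  induction N using Quotient.inductionOn with | _ ν
  have h₁ := Extension.toClass_le_toClass.1 h
  have h₂ := Extension.toClass_le_toClass.1 h'
  exact Quotient.sound fun g f =>
    ⟨Extension.val_le_of_leAt h₁ h₂, Extension.val_le_of_leAt h₂ h₁⟩

/-! ### Ultraproducts of valuations -/

section Ultraproduct

variable {J : Type*} {Γ : Type*} [AddCommGroup Γ]

open scoped Classical in
/-- The element of `*Γ ∪ {∞}`, with `*Γ` an ultrapower of `Γ`, given by a family in `Γ ∪ {∞}`. -/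
noncomputable def ultraTop (U : Ultrafilter J) (x : J → WithTop Γ) :
    WithTop ((U : Filter J).Germ Γ) :=
  if ∀ᶠ j in (U : Filter J), x j = ⊤ then ⊤
  -- The default `0` is used only on a set outside `U`, so it does not affect the germ.
  else ((fun j => (x j).untopD 0 : J → Γ) : (U : Filter J).Germ Γ)

variable {U : Ultrafilter J} {x y z : J → WithTop Γ}

theorem ultraTop_of_top (h : ∀ᶠ j in (U : Filter J), x j = ⊤) : ultraTop U x = ⊤ := if_pos h

theorem ultraTop_of_not_top (h : ¬ ∀ᶠ j in (U : Filter J), x j = ⊤) :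
    ultraTop U x = (((fun j => (x j).untopD 0 : J → Γ) : (U : Filter J).Germ Γ) :) := if_neg h

variable [LinearOrder Γ]

theorem ultraTop_le_iff : ultraTop U x ≤ ultraTop U y ↔ ∀ᶠ j in (U : Filter J), x j ≤ y j := by
  by_cases hy : ∀ᶠ j in (U : Filter J), y j = ⊤
  · rw [ultraTop_of_top hy]
    exact iff_of_true le_top (hy.mono fun j h => h ▸ le_top)
  have hy' := Ultrafilter.eventually_not.2 hy
  by_cases hx : ∀ᶠ j in (U : Filter J), x j = ⊤
  · rw [ultraTop_of_top hx, ultraTop_of_not_top hy]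
    refine iff_of_false (by simp only [top_le_iff, WithTop.coe_ne_top, not_false_eq_true]) ?_
    intro h
    obtain ⟨j, h1, h2, h3⟩ := (hy'.and (hx.and h)).exists
    exact h1 (top_le_iff.1 (h2 ▸ h3))
  have hx' := Ultrafilter.eventually_not.2 hx
  rw [ultraTop_of_not_top hx, ultraTop_of_not_top hy, WithTop.coe_le_coe, Filter.Germ.coe_le]
  refine Filter.eventually_congr ?_
  filter_upwards [hx', hy'] with j h1 h2
  obtain ⟨a, ha⟩ := WithTop.ne_top_iff_exists.1 h1
  obtain ⟨b, hb⟩ := WithTop.ne_top_iff_exists.1 h2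
  rw [← ha, ← hb, WithTop.untopD_coe, WithTop.untopD_coe, WithTop.coe_le_coe]

theorem min_ultraTop_le (h : ∀ j, min (x j) (y j) ≤ z j) :
    min (ultraTop U x) (ultraTop U y) ≤ ultraTop U z := by
  rw [min_le_iff, ultraTop_le_iff, ultraTop_le_iff, ← Ultrafilter.eventually_or]
  exact Filter.Eventually.of_forall fun j => min_le_iff.1 (h j)

variable [IsOrderedAddMonoid Γ]

theorem ultraTop_add : ultraTop U (x + y) = ultraTop U x + ultraTop U y := by
  by_cases hx : ∀ᶠ j in (U : Filter J), x j = ⊤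
  · rw [ultraTop_of_top hx, top_add]
    exact ultraTop_of_top (hx.mono fun j h => by rw [Pi.add_apply, h, top_add])
  by_cases hy : ∀ᶠ j in (U : Filter J), y j = ⊤
  · rw [ultraTop_of_top hy, add_top]
    exact ultraTop_of_top (hy.mono fun j h => by rw [Pi.add_apply, h, add_top])
  have hx' := Ultrafilter.eventually_not.2 hx
  have hy' := Ultrafilter.eventually_not.2 hy
  have hxy : ¬ ∀ᶠ j in (U : Filter J), (x + y) j = ⊤ := by
    intro h
    obtain ⟨j, h1, h2, h3⟩ := (hx'.and (hy'.and h)).exists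
    exact (WithTop.add_eq_top.1 h3).elim h1 h2
  rw [ultraTop_of_not_top hx, ultraTop_of_not_top hy, ultraTop_of_not_top hxy, ← WithTop.coe_add,
    ← Filter.Germ.coe_add, WithTop.coe_inj, Filter.Germ.coe_eq]
  filter_upwards [hx', hy'] with j h1 h2
  obtain ⟨a, ha⟩ := WithTop.ne_top_iff_exists.1 h1
  obtain ⟨b, hb⟩ := WithTop.ne_top_iff_exists.1 h2
  rw [Pi.add_apply, Pi.add_apply, ← ha, ← hb, ← WithTop.coe_add, WithTop.untopD_coe,
    WithTop.untopD_coe, WithTop.untopD_coe]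

theorem ultraTop_zero : ultraTop U (0 : J → WithTop Γ) = 0 := by
  have h := ultraTop_add (U := U) (x := (0 : J → WithTop Γ)) (y := 0)
  have h0 : ¬ ∀ᶠ j in (U : Filter J), (0 : J → WithTop Γ) j = ⊤ := by
    rw [← Ultrafilter.eventually_not]
    exact Filter.Eventually.of_forall fun j => WithTop.zero_ne_top
  rw [ultraTop_of_not_top h0]
  rfl

/-- The ultraproduct of a family of valuations. -/
noncomputable def ultraVal {R : Type*} [CommRing R] (U : Ultrafilter J)
    (w : J → AddValuation R (WithTop Γ)) : AddValuation R (WithTop ((U : Filter J).Germ Γ)) :=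
  AddValuation.of (fun f => ultraTop U fun j => w j f)
    (ultraTop_of_top (Filter.Eventually.of_forall fun j => (w j).map_zero))
    (by
      simp only [AddValuation.map_one]
      exact ultraTop_zero)
    (fun f g => min_ultraTop_le fun j => (w j).map_add f g)
    (fun f g => by
      simp only [AddValuation.map_mul]
      exact ultraTop_add)

theorem ultraVal_le_ultraVal {R : Type*} [CommRing R] {w : J → AddValuation R (WithTop Γ)}
    {f g : R} : ultraVal U w f ≤ ultraVal U w g ↔ ∀ᶠ j in (U : Filter J), w j f ≤ w j g :=
  ultraTop_le_iff

end Ultraproduct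

variable {K : Type u} [Field K] {Γ : Type w} [AddCommGroup Γ] [LinearOrder Γ]
  [IsOrderedAddMonoid Γ] {v : AddValuation K (WithTop Γ)}

/-! ### Monomial valuations and balls -/

/-- Each term `a_i (x - a) ^ i` of the Taylor expansion has `μ`-value at least `v (a_i) + i γ`:
`v_{a,γ}` is minimal among these extensions. -/
theorem monomialVal_le {a : K} {γ : Γ} (μ : AddValuation K[X] (WithTop Γ))
    (hC : ∀ c, μ (C c) = v c) (h : (γ : WithTop Γ) ≤ μ (X - C a)) (f : K[X]) :
    monomialVal v a γ f ≤ μ f := by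
  conv_rhs => rw [← sum_taylor_eq f a]
  refine μ.map_le_sum fun i _ => ?_
  rw [AddValuation.map_mul, AddValuation.map_pow, hC]
  exact (weight_le _ i).trans (by gcongr)

theorem monomialVal_eq_top {a : K} {γ : Γ} {f : K[X]} : monomialVal v a γ f = ⊤ ↔ f = 0 := by
  constructor
  · intro h
    by_contra hf
    exact (exists_weight_eq (v := v) (γ := γ) ((taylor_injective a).ne_iff' (map_zero _) |>.2 hf)).1 h
  · rintro rfl
    exact AddValuation.map_zero _

theorem monomialVal_X_sub_C (a b : K) (γ : Γ) :
    monomialVal v b γ (X - C a) = min (v (b - a)) (γ : WithTop Γ) := by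
  change weight v γ (taylor b (X - C a)) = _
  have h : taylor b (X - C a) = X + C (b - a) := by
    rw [map_sub, taylor_X, taylor_C, C_sub]; ring
  rw [h]
  generalize b - a = d
  refine le_antisymm (le_min ?_ ?_) (le_weight fun i => ?_)
  · refine (weight_le (X + C d) 0).trans_eq ?_
    rw [coeff_add, coeff_X_zero, coeff_C_zero, zero_add, zero_nsmul, add_zero]
  · refine (weight_le (X + C d) 1).trans_eq ?_
    rw [coeff_add, coeff_X_one, coeff_C_succ, add_zero, one_nsmul, AddValuation.map_one, zero_add]
  · rcases i with _ | _ | i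
    · simp
    · simp
    · simp [coeff_X]

theorem monomialVal_mono {a b : K} {γ δ : Γ} (h : γ ≤ δ) (hab : (γ : WithTop Γ) ≤ v (b - a))
    (f : K[X]) : monomialVal v a γ f ≤ monomialVal v b δ f := by
  refine monomialVal_le _ (monomialVal_C v b δ) ?_ f
  rw [monomialVal_X_sub_C]
  exact le_min hab (WithTop.coe_le_coe.2 h)

/-- A valuation on `K[X]` that extends `v` up to equivalence. -/
def Extension.ofVal {G : Type w} [AddCommGroup G] [LinearOrder G] [IsOrderedAddMonoid G]
    (μ : AddValuation K[X] (WithTop G)) (h : ∀ c d, μ (C c) ≤ μ (C d) ↔ v c ≤ v d) :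
    Extension v where
  G := G
  val := μ
  restrict_isEquiv := fun c d => h d c

/-- The monomial valuation `v_{a,γ}` as an extension of `v`. -/
noncomputable def monomialExt (v : AddValuation K (WithTop Γ)) (a : K) (γ : valueGroup v) :
    Extension v :=
  .ofVal (monomialVal v a γ) fun c d => by rw [monomialVal_C, monomialVal_C]

theorem toClass_monomialExt (a : K) (γ : valueGroup v) :
    (monomialExt v a γ).toClass = monomialClass v a γ := rfl

theorem monomialClass_mono {a b : K} {γ δ : valueGroup v} (h : γ ≤ δ)
    (hab : ((γ : Γ) : WithTop Γ) ≤ v (b - a)) : monomialClass v a γ ≤ monomialClass v b δ := by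
  rw [← toClass_monomialExt, ← toClass_monomialExt, Extension.toClass_le_toClass]
  intro f
  have hle : monomialVal v a γ f ≤ monomialVal v b δ f :=
    monomialVal_mono (Subtype.coe_le_coe.2 h) hab f
  refine ⟨fun n c _ _ h1 => ?_, fun n c _ _ h1 => ?_, fun h1 => top_le_iff.1 (h1.ge.trans hle)⟩
  · change monomialVal v a γ (C c) ≤ n • monomialVal v a γ f at h1
    change monomialVal v b δ (C c) ≤ n • monomialVal v b δ f
    rw [monomialVal_C] at h1 ⊢
    exact h1.trans (nsmul_le_nsmul_right hle n)
  · change n • monomialVal v b δ f ≤ monomialVal v b δ (C c) at h1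
    change n • monomialVal v a γ f ≤ monomialVal v a γ (C c)
    rw [monomialVal_C] at h1 ⊢
    exact (nsmul_le_nsmul_right hle n).trans h1

theorem le_val_sub_of_closedBall_subset {a b : K} {γ δ : valueGroup v}
    (h : closedBall v b δ ⊆ closedBall v a γ) : ((γ : Γ) : WithTop Γ) ≤ v (b - a) :=
  h (mem_closedBall_self v b δ)

theorem radius_le_of_closedBall_subset {a b : K} {γ δ : valueGroup v}
    (h : closedBall v b δ ⊆ closedBall v a γ) : γ ≤ δ := by
  obtain ⟨d, hd⟩ := δ.2
  -- Radii lie in the value group, so the smaller ball has a point at distance exactly `δ` from `b`.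
  have h1 : b + d ∈ closedBall v a γ := h (by simp [closedBall, hd])
  have h2 := v.map_le_sub h1 (le_val_sub_of_closedBall_subset h)
  rw [show b + d - a - (b - a) = d by ring, hd] at h2
  exact Subtype.coe_le_coe.1 (WithTop.coe_le_coe.1 h2)

theorem monomialClass_le_of_subset {a b : K} {γ δ : valueGroup v}
    (h : closedBall v b δ ⊆ closedBall v a γ) : monomialClass v a γ ≤ monomialClass v b δ :=
  monomialClass_mono (radius_le_of_closedBall_subset h) (le_val_sub_of_closedBall_subset h)

/-! ### The least class -/

/-- The leading term alone already pushes the value below every constant. -/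
theorem nsmul_monomialVal_lt {G : Type*} [AddCommGroup G] [LinearOrder G] [IsOrderedAddMonoid G]
    {μ : AddValuation K (WithTop G)} {g : G}
    (hg : ∀ (c d : K) (m : ℕ), c ≠ 0 → m ≠ 0 → μ c + m • (g : WithTop G) < μ d) {f : K[X]}
    (hf : 0 < f.natDegree) {n : ℕ} (hn : n ≠ 0) (c : K) :
    n • monomialVal μ 0 g f < monomialVal μ 0 g (C c) := by
  have hlc : f.leadingCoeff ≠ 0 := leadingCoeff_ne_zero.2 (ne_zero_of_natDegree_gt hf)
  have h : monomialVal μ 0 g f ≤ μ f.leadingCoeff + f.natDegree • (g : WithTop G) := by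
    change weight μ g (taylor 0 f) ≤ _
    rw [taylor_zero]
    exact weight_le f f.natDegree
  rw [monomialVal_C]
  calc n • monomialVal μ 0 g f ≤ n • (μ f.leadingCoeff + f.natDegree • (g : WithTop G)) :=
        nsmul_le_nsmul_right h n
    _ = μ (f.leadingCoeff ^ n) + (f.natDegree * n) • (g : WithTop G) := by
        rw [nsmul_add, AddValuation.map_pow, mul_nsmul]
    _ < μ c := hg _ _ _ (pow_ne_zero _ hlc) (Nat.mul_ne_zero hf.ne' hn)

theorem exists_nsmul_lt_of {G : Type w} [AddCommGroup G] [LinearOrder G] [IsOrderedAddMonoid G]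
    (μ : AddValuation K (WithTop G)) (hμ : ∀ c d, μ c ≤ μ d ↔ v c ≤ v d) {g : G}
    (hg : ∀ (c d : K) (m : ℕ), c ≠ 0 → m ≠ 0 → μ c + m • (g : WithTop G) < μ d) :
    ∃ ν : Extension v,
      ∀ (f : K[X]) (n : ℕ) (c : K), 0 < f.natDegree → n ≠ 0 → n • ν.val f < ν.val (C c) :=
  ⟨.ofVal (monomialVal μ 0 g) fun c d => by rw [monomialVal_C, monomialVal_C, hμ],
    fun _ _ c hf hn => nsmul_monomialVal_lt hg hf hn c⟩

/-- Nonconstant polynomials have the least cut `(∅, Γ_ℚ)`, and constants have the same position in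
every extension. This class is the supremum of the empty nest. -/
theorem toClass_le_of_nsmul_lt {μ : Extension v}
    (hμ : ∀ (f : K[X]) (n : ℕ) (c : K), 0 < f.natDegree → n ≠ 0 → n • μ.val f < μ.val (C c))
    (ν : Extension v) : μ.toClass ≤ ν.toClass := by
  rw [Extension.toClass_le_toClass]
  intro f
  rcases Nat.eq_zero_or_pos f.natDegree with hf | hf
  · obtain ⟨d, rfl⟩ := natDegree_eq_zero.1 hf
    refine ⟨fun n c hn _ h => ?_, fun n c hn _ h => ?_, fun h => ?_⟩
    · rw [← AddValuation.map_pow, ← C_pow, Extension.val_C_le_val_C] at h ⊢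
      exact h
    · rw [← AddValuation.map_pow, ← C_pow, Extension.val_C_le_val_C] at h ⊢
      exact h
    · by_cases hd : d = 0
      · rw [hd, C_0, AddValuation.map_zero]
      · exact absurd h (μ.val_C_ne_top hd)
  · refine ⟨fun n c hn _ h => absurd h (hμ f n c hf hn).not_ge,
      fun n c hn _ h => (hμ f n c hf hn).le, fun h => ?_⟩
    have := hμ f 1 1 hf one_ne_zero
    rw [one_smul, h] at this
    exact absurd this not_top_lt

/-- The group `ℤ × Γ`, ordered lexicographically. -/
def IntLex (Γ : Type*) : Type _ := ℤ ×ₗ Γ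

namespace IntLex

variable {Γ : Type*}

/-- The element of `ℤ × Γ` with given components. -/
def mk (n : ℤ) (γ : Γ) : IntLex Γ := toLex (n, γ)

instance [AddCommGroup Γ] : AddCommGroup (IntLex Γ) := inferInstanceAs (AddCommGroup (ℤ ×ₗ Γ))

theorem mk_add_mk [AddCommGroup Γ] (m n : ℤ) (γ δ : Γ) : mk m γ + mk n δ = mk (m + n) (γ + δ) := rfl

theorem nsmul_mk [AddCommGroup Γ] (k : ℕ) (n : ℤ) (γ : Γ) : k • mk n γ = mk (k • n) (k • γ) := rfl

variable [LinearOrder Γ]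

instance : LinearOrder (IntLex Γ) := inferInstanceAs (LinearOrder (ℤ ×ₗ Γ))

theorem mk_le_mk {m n : ℤ} {γ δ : Γ} : mk m γ ≤ mk n δ ↔ m < n ∨ m = n ∧ γ ≤ δ :=
  Prod.Lex.toLex_le_toLex

theorem mk_lt_mk {m n : ℤ} {γ δ : Γ} : mk m γ < mk n δ ↔ m < n ∨ m = n ∧ γ < δ :=
  Prod.Lex.toLex_lt_toLex

instance [AddCommGroup Γ] [IsOrderedAddMonoid Γ] : IsOrderedAddMonoid (IntLex Γ) :=
  inferInstanceAs (IsOrderedAddMonoid (ℤ ×ₗ Γ))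

end IntLex

/-- The inclusion of `Γ ∪ {∞}` in `(ℤ × Γ) ∪ {∞}`. -/
def lexIncl (Γ : Type*) [AddCommGroup Γ] : WithTop Γ →+ WithTop (IntLex Γ) :=
  AddMonoidHom.withTopMap
    { toFun := fun γ => IntLex.mk 0 γ
      map_zero' := rfl
      map_add' := fun _ _ => rfl }

theorem lexIncl_coe (Γ : Type*) [AddCommGroup Γ] (γ : Γ) :
    lexIncl Γ (γ : WithTop Γ) = IntLex.mk 0 γ := rfl

theorem lexIncl_top (Γ : Type*) [AddCommGroup Γ] : lexIncl Γ ⊤ = ⊤ := rfl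

theorem lexIncl_le_iff {Γ : Type*} [AddCommGroup Γ] [LinearOrder Γ] {x y : WithTop Γ} : lexIncl Γ x ≤ lexIncl Γ y ↔ x ≤ y := by
  induction y with
  | top => simp [lexIncl_top]
  | coe y =>
    induction x with
    | top => simp [lexIncl_top, lexIncl_coe]
    | coe x =>
      rw [lexIncl_coe, lexIncl_coe, WithTop.coe_le_coe, WithTop.coe_le_coe, IntLex.mk_le_mk]
      simp

/-- The valuation `v` with values in `ℤ × Γ`, ordered lexicographically. -/
def lexVal (v : AddValuation K (WithTop Γ)) : AddValuation K (WithTop (IntLex Γ)) :=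
  v.map (lexIncl Γ) (lexIncl_top Γ) fun _ _ h => lexIncl_le_iff.2 h

theorem lexVal_apply (c : K) : lexVal v c = lexIncl Γ (v c) := rfl

/-- The coordinate in `ℤ` dominates, so a positive multiple of `(-1, 0)` outweighs any element of
`Γ`. -/
theorem lexVal_add_nsmul_lt (c d : K) (m : ℕ) (hc : c ≠ 0) (hm : m ≠ 0) :
    lexVal v c + m • (IntLex.mk (-1) (0 : Γ) : WithTop (IntLex Γ)) < lexVal v d := by
  obtain ⟨γ, hγ⟩ := exists_coe_eq (v := v) hc
  rw [lexVal_apply, lexVal_apply, hγ, lexIncl_coe, ← WithTop.coe_nsmul, ← WithTop.coe_add]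
  by_cases hd : d = 0
  · rw [hd, AddValuation.map_zero, lexIncl_top]
    exact WithTop.coe_lt_top _
  obtain ⟨δ, hδ⟩ := exists_coe_eq (v := v) hd
  rw [hδ, lexIncl_coe, WithTop.coe_lt_coe, IntLex.nsmul_mk, IntLex.mk_add_mk, IntLex.mk_lt_mk]
  left
  simp only [zero_add, smul_neg, nsmul_eq_mul, mul_one, neg_lt_zero]
  positivity

theorem exists_nsmul_lt (v : AddValuation K (WithTop Γ)) : ∃ μ : Extension v,
    ∀ (f : K[X]) (n : ℕ) (c : K), 0 < f.natDegree → n ≠ 0 → n • μ.val f < μ.val (C c) :=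
  exists_nsmul_lt_of (lexVal v) (fun _ _ => lexIncl_le_iff) lexVal_add_nsmul_lt

/-! ### The supremum of a nest -/

namespace ApproxType

/-- The classes of the monomial valuations of the balls in an approximation type. -/
def classes (A : ApproxType v) : Set (ExtClass v) :=
  {N | ∃ (a : K) (γ : valueGroup v), closedBall v a γ ∈ A.carrier ∧ N = monomialClass v a γ}

/-- Comparable balls of equal radius contain each other's centres; hence the independence of the
choice of centres. -/
theorem monomialClass_eq {A : ApproxType v} {a b : K} {γ : valueGroup v}
    (ha : closedBall v a γ ∈ A.carrier) (hb : closedBall v b γ ∈ A.carrier) :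
    monomialClass v a γ = monomialClass v b γ := by
  have hab : ((γ : Γ) : WithTop Γ) ≤ v (b - a) := by
    rcases A.chain.total ha hb with h | h
    · rw [AddValuation.map_sub_swap]
      exact le_val_sub_of_closedBall_subset h
    · exact le_val_sub_of_closedBall_subset h
  refine ExtClass.le_antisymm (monomialClass_mono le_rfl hab) (monomialClass_mono le_rfl ?_)
  rwa [AddValuation.map_sub_swap]

theorem classes_eq {A : ApproxType v} {c : valueGroup v → K}
    (hc : ∀ γ ∈ A.supp, closedBall v (c γ) γ ∈ A.carrier) :
    {N | ∃ γ ∈ A.supp, N = monomialClass v (c γ) γ} = A.classes := by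
  ext N
  constructor
  · rintro ⟨γ, hγ, rfl⟩
    exact ⟨c γ, γ, hc γ hγ, rfl⟩
  · rintro ⟨a, γ, ha, rfl⟩
    exact ⟨γ, ⟨a, ha⟩, monomialClass_eq ha (hc γ ⟨a, ha⟩)⟩

theorem mem_of_subset {A : ApproxType v} {B B' : Set K} (hB : IsBall v B) (hB' : B' ∈ A.carrier)
    (h : B' ⊆ B) : B ∈ A.carrier := by
  rw [← A.enlarge_eq]
  exact ⟨hB, B', hB', h⟩

theorem monomialVal_mono_supp {A : ApproxType v} {c : valueGroup v → K}
    (hc : ∀ γ ∈ A.supp, closedBall v (c γ) γ ∈ A.carrier) {γ δ : A.supp} (h : γ ≤ δ) (f : K[X]) :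
    monomialVal v (c γ) (γ : valueGroup v) f ≤ monomialVal v (c δ) (δ : valueGroup v) f := by
  refine monomialVal_mono (Subtype.coe_le_coe.2 (Subtype.coe_le_coe.2 h)) ?_ f
  rcases A.chain.total (hc γ γ.2) (hc δ δ.2) with h' | h'
  -- An inclusion in the unexpected direction forces equal radii, and then equal chosen centres.
  · have e : γ = δ := h.antisymm (radius_le_of_closedBall_subset h')
    rw [e, sub_self, AddValuation.map_zero]
    exact le_top
  · exact le_val_sub_of_closedBall_subset h'

/-- The ultraproduct of the monomial valuations of a nest of balls, along an ultrafilter of sets of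
radii. -/
noncomputable def ultraExt (A : ApproxType v) (c : valueGroup v → K) (U : Ultrafilter A.supp) :
    Extension v :=
  -- Indexing by radii keeps the ultrapower in the universe of `Γ`, as `Extension` requires.
  .ofVal (ultraVal U fun γ : A.supp => monomialVal v (c γ) (γ : valueGroup v)) fun a b => by
    simp only [ultraVal_le_ultraVal, monomialVal_C, Filter.eventually_const]

theorem val_C_le_ultraExt_iff {A : ApproxType v} {c : valueGroup v → K} {U : Ultrafilter A.supp}
    {d : K} {n : ℕ} {f : K[X]} :
    (A.ultraExt c U).val (C d) ≤ n • (A.ultraExt c U).val f ↔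
      ∀ᶠ γ : A.supp in (U : Filter A.supp), v d ≤ n • monomialVal v (c γ) (γ : valueGroup v) f := by
  rw [← AddValuation.map_pow]
  refine ultraVal_le_ultraVal.trans ?_
  simp only [monomialVal_C, AddValuation.map_pow]

theorem ultraExt_le_val_C_iff {A : ApproxType v} {c : valueGroup v → K} {U : Ultrafilter A.supp}
    {d : K} {n : ℕ} {f : K[X]} :
    n • (A.ultraExt c U).val f ≤ (A.ultraExt c U).val (C d) ↔
      ∀ᶠ γ : A.supp in (U : Filter A.supp), n • monomialVal v (c γ) (γ : valueGroup v) f ≤ v d := by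
  rw [← AddValuation.map_pow]
  refine ultraVal_le_ultraVal.trans ?_
  simp only [monomialVal_C, AddValuation.map_pow]

theorem ultraExt_eq_top {A : ApproxType v} {c : valueGroup v → K} {U : Ultrafilter A.supp}
    {f : K[X]} (h : (A.ultraExt c U).val f = ⊤) : f = 0 := by
  have h1 : (A.ultraExt c U).val 0 ≤ (A.ultraExt c U).val f := by rw [h]; exact le_top
  obtain ⟨γ, hγ⟩ := (ultraVal_le_ultraVal.1 h1).exists
  rw [AddValuation.map_zero, top_le_iff] at hγ
  exact monomialVal_eq_top.1 hγ

/-- By monotonicity, a lower bound in `Γ_ℚ` for the value of `f` persists once reached, and an upper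
bound holds in the limit only if it holds at every radius. No nonzero polynomial gets an infinite
value. -/
theorem isLUB_ultraExt {A : ApproxType v} {c : valueGroup v → K}
    (hc : ∀ γ ∈ A.supp, closedBall v (c γ) γ ∈ A.carrier) {U : Ultrafilter A.supp}
    (hU : (U : Filter A.supp) ≤ Filter.atTop) :
    IsLUB A.classes (A.ultraExt c U).toClass := by
  rw [← classes_eq hc]
  constructor
  · rintro _ ⟨γ, hγ, rfl⟩
    rw [← toClass_monomialExt, Extension.toClass_le_toClass]
    have hev : ∀ᶠ δ in (U : Filter A.supp), (⟨γ, hγ⟩ : A.supp) ≤ δ :=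
      hU (Filter.eventually_ge_atTop _)
    intro f
    refine ⟨fun n d _ _ h => ?_, fun n d _ _ h => ?_, fun h => ?_⟩
    · change monomialVal v (c γ) γ (C d) ≤ n • monomialVal v (c γ) γ f at h
      rw [monomialVal_C] at h
      rw [val_C_le_ultraExt_iff]
      filter_upwards [hev] with δ hδ
      exact h.trans (nsmul_le_nsmul_right (monomialVal_mono_supp hc hδ f) n)
    · change n • monomialVal v (c γ) γ f ≤ monomialVal v (c γ) γ (C d)
      rw [monomialVal_C]
      obtain ⟨δ, h1, h2⟩ := (hev.and (ultraExt_le_val_C_iff.1 h)).exists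
      exact (nsmul_le_nsmul_right (monomialVal_mono_supp hc h1 f) n).trans h2
    · rw [monomialVal_eq_top.1 h, AddValuation.map_zero]
  · intro N hN
    induction N using Quotient.inductionOn with | _ ν
    have hν : ∀ γ : A.supp, ∀ f, Extension.LeAt (monomialExt v (c γ) γ) ν f := fun γ =>
      Extension.toClass_le_toClass.1 (hN ⟨γ.1, γ.2, rfl⟩)
    refine Extension.toClass_le_toClass.2 fun f => ⟨fun n d hn hd h => ?_, fun n d hn hd h => ?_,
      fun h => ?_⟩
    · obtain ⟨γ, hγ⟩ := (val_C_le_ultraExt_iff.1 h).exists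
      refine (hν γ f).1 n d hn hd ?_
      change monomialVal v (c γ) (γ : valueGroup v) (C d) ≤ _
      rwa [monomialVal_C]
    · rw [ultraExt_le_val_C_iff]
      refine Filter.Eventually.of_forall fun γ => ?_
      have h1 : _ ≤ monomialVal v (c γ) (γ : valueGroup v) (C d) := (hν γ f).2.1 n d hn hd h
      rwa [monomialVal_C] at h1
    · rw [ultraExt_eq_top h, AddValuation.map_zero]

/-- The classes of an approximation type have a supremum, and the approximation type can be
recovered from it. -/
theorem exists_isLUB (A : ApproxType v) : ∃ μ : Extension v, IsLUB A.classes μ.toClass ∧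
    ∀ (a : K) (γ : valueGroup v) (d : K), v d = ((γ : Γ) : WithTop Γ) →
      μ.val (C d) ≤ μ.val (X - C a) → closedBall v a γ ∈ A.carrier := by
  have hex : ∀ γ : valueGroup v, ∃ c : K, γ ∈ A.supp → closedBall v c γ ∈ A.carrier := by
    intro γ
    by_cases h : γ ∈ A.supp
    · exact h.imp fun a ha _ => ha
    · exact ⟨0, fun h' => absurd h' h⟩
  choose c hc using hex
  -- An empty nest gives no ultrafilter; its supremum is the least class.
  rcases isEmpty_or_nonempty A.supp with he | he
  · obtain ⟨μ, hμ⟩ := exists_nsmul_lt v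
    refine ⟨μ, ⟨?_, fun N _ => ?_⟩, fun a γ d hd h => ?_⟩
    · rintro _ ⟨a, γ, ha, -⟩
      exact he.elim ⟨γ, a, ha⟩
    · induction N using Quotient.inductionOn with | _ ν
      exact toClass_le_of_nsmul_lt hμ ν
    · have := hμ (X - C a) 1 d (by simp) one_ne_zero
      rw [one_smul] at this
      exact absurd h this.not_ge
  · refine ⟨A.ultraExt c (Ultrafilter.of Filter.atTop), isLUB_ultraExt hc (Ultrafilter.of_le _),
      fun a γ d hd h => ?_⟩
    -- Some ball `B(c δ, δ)` of the nest has `min (v (c δ - a)) δ ≥ γ`, so it lies in `B(a,γ)`, and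
    -- closure under enlargement applies.
    rw [← one_smul ℕ (Extension.val _ (X - C a)), val_C_le_ultraExt_iff] at h
    obtain ⟨δ, hδ⟩ := h.exists
    rw [one_smul, monomialVal_X_sub_C, hd, le_min_iff] at hδ
    exact mem_of_subset ⟨a, γ, rfl⟩ (hc δ δ.2)
      (closedBall_subset (Subtype.coe_le_coe.1 (WithTop.coe_le_coe.1 hδ.2)) hδ.1)

/-- A ball `B(a,γ)` of `A` forces the value of `x - a` in the supremum to be at least `γ`, which
puts the ball in `A'`. -/
theorem subset_of_isLUB {A A' : ApproxType v} {M : ExtClass v} (h : IsLUB A.classes M)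
    (h' : IsLUB A'.classes M) : A.carrier ⊆ A'.carrier := by
  obtain ⟨μ, hμ, hrec⟩ := A'.exists_isLUB
  intro B hB
  obtain ⟨a, γ, rfl⟩ := A.isBall B hB
  have hle : monomialClass v a γ ≤ μ.toClass := (h.1 ⟨a, γ, hB, rfl⟩).trans (h'.2 hμ.1)
  rw [← toClass_monomialExt, Extension.toClass_le_toClass] at hle
  obtain ⟨d, hd⟩ := γ.2
  have h1 := (hle (X - C a)).1 1 d one_ne_zero (ne_zero_of_eq_coe hd) (by
    rw [one_smul]
    change monomialVal v a γ (C d) ≤ monomialVal v a γ (X - C a)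
    rw [monomialVal_C, monomialVal_X_sub_C, hd, sub_self, AddValuation.map_zero]
    exact le_min le_top le_rfl)
  rw [one_smul] at h1
  exact hrec a γ d hd h1

end ApproxType

/-! ### Uniqueness, pseudo-Cauchy sequences and the theorem -/

theorem isLUB_iff_eq {s : Set (ExtClass v)} {M N : ExtClass v} (hN : IsLUB s N) :
    IsLUB s M ↔ M = N :=
  ⟨fun h => ExtClass.le_antisymm (h.2 hN.1) (hN.2 h.1), fun h => h ▸ hN⟩

/-- Larger balls give smaller classes, and every ball of `S.iota` contains some `B(a_i, γ_i)`, so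
the extra balls impose no new bounds. -/
theorem PseudoCauchySeq.upperBounds_range (S : PseudoCauchySeq.{u, w, s} v) :
    upperBounds (Set.range fun i : S.IStar => monomialClass v (S.a i.1) (S.radius i)) =
      upperBounds S.iota.classes := by
  ext M
  constructor
  · rintro hM _ ⟨a, γ, ⟨-, _, ⟨i, rfl⟩, h⟩, rfl⟩
    exact (monomialClass_le_of_subset h).trans (hM ⟨i, rfl⟩)
  · rintro hM _ ⟨i, rfl⟩
    exact hM ⟨_, _, ⟨⟨_, _, rfl⟩, _, ⟨i, rfl⟩, subset_rfl⟩, rfl⟩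

end ValApprox

theorem mainTheorem3 {K : Type u} [Field K] {Γ : Type w} [AddCommGroup Γ] [LinearOrder Γ]
    [IsOrderedAddMonoid Γ] (v : AddValuation K (WithTop Γ)) :
    ∃ (Φ : ApproxType v → ExtClass v) (Ψ : PseudoCauchySeq.{u, w, s} v → ExtClass v),
      (∀ (A : ApproxType v) (c : valueGroup v → K),
        (∀ γ ∈ A.supp, closedBall v (c γ) γ ∈ A.carrier) →
          ∀ M : ExtClass v, IsLUB {N | ∃ γ ∈ A.supp, N = monomialClass v (c γ) γ} M ↔ M = Φ A) ∧
      (∀ (S : PseudoCauchySeq.{u, w, s} v) (M : ExtClass v),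
        IsLUB (Set.range fun i : S.IStar => monomialClass v (S.a i.1) (S.radius i)) M ↔
          M = Ψ S) ∧
      Function.Injective Φ ∧
      Ψ = Φ ∘ PseudoCauchySeq.iota := by
  choose μ hμ _ using fun A : ApproxType v => A.exists_isLUB
  -- With `Ψ` defined through `iota`, the content of (iii) moves into the supremum property of `Ψ`.
  refine ⟨fun A => (μ A).toClass, fun S => (μ S.iota).toClass, ?_, ?_, ?_, rfl⟩
  · intro A c hc M
    rw [ApproxType.classes_eq hc]
    exact isLUB_iff_eq (hμ A)
  · intro S M
    rw [IsLUB, S.upperBounds_range]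
    exact isLUB_iff_eq (hμ S.iota)
  · intro A A' h
    have h' : IsLUB A.classes (μ A').toClass := by
      have := hμ A
      rwa [show (μ A).toClass = (μ A').toClass from h] at this
    have e : A.carrier = A'.carrier :=
      (ApproxType.subset_of_isLUB h' (hμ A')).antisymm (ApproxType.subset_of_isLUB (hμ A') h')
    cases A
    cases A'
    simpa using e
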